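/- **Theorem 3.4 (Tropical basis of the schön embedding).** Let $\kappa$ be an algebraically closed field, equipped with the trivial valuation, and let $G$ be a finite simple 3-regular three-connected planar graph with a planar embedding. Let $F$ be the set of all faces of the embedding, $e\in F$ the outer face, and $R=\kappa[x_f : f\in F,\ f\neq e]$. For each vertex $v$ of $G$ let $L_v\subset R$ be the ideal generated by the variables $x_f$ of all interior faces $f$ not incident to $v$ together with, if $v$ is not incident to $e$, the sum of the variables of the three faces incident to $v$. Let $I_{sch}=\bigcap_v L_v$, the ideal of the line arrangement in $\operatorname{Proj}(R)$ that is called the schön embedding. Let $M$ be the simplicial complex with vertex set $F$ in which a nonempty set of faces is a simplex if and only if its members are incident to a common vertex of $G$ (the boundary complex of the dual of the three-dimensional polytope with graph $G$). Let $\mathcal G\subset R$ be the set of all polynomials obtained from the minimal monomial generators $\prod_{f\in N}x_f$ ($N$ a minimal nonface of $M$) of the Stanley–Reisner ideal of $M$ by substituting $x_e\mapsto-\sum_{f\in F,\,f\neq e}x_f$. For homogeneous $h\in R$ let $\operatorname{tropproj}(h)$ be the union of the closure of the tropical hypersurface of $h$ (the classes of those $w\in\mathbb R^{F\setminus\{e\}}$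 for which the minimum of $w\cdot\alpha$ over the exponents $\alpha$ of $h$ is attained at least twice; all $w$ if $h=0$) in the tropical projective space $\mathbb{TP}=\big((\mathbb R\cup\{\infty\})^{F\setminus\{e\}}\setminus\{(\infty,\dots,\infty)\}\big)/\mathbb R(1,\dots,1)$ with the facets $\{p_f=\infty\}$ of $\mathbb{TP}$ for all variables $x_f$ dividing $h$. For a homogeneous ideal $I$ let $\operatorname{tropproj}(I)=\bigcap_{h}\operatorname{tropproj}(h)$ over all homogeneous $h\in I$. Then $\mathcal G$ is a minimal generating set of $I_{sch}$ (it generates $I_{sch}$ and no proper subset of it does), it consists of homogeneous elements of $I_{sch}$, and it is a tropical basis of $I_{sch}$ in tropical projective space: $$\bigcap_{h\in\mathcal G}\operatorname{tropproj}(h)=\operatorname{tropproj}(I_{sch}).$$ -/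

import Mathlib

open MvPolynomial

noncomputable section

namespace Schoen

/-! ### Three-connected graphs and their plane embeddings -/

/-- `G` is three-(vertex-)connected: it has more than three vertices and stays connected
after the removal of any set of at most two vertices. -/
def IsThreeConnected {V : Type*} (G : SimpleGraph V) : Prop :=
  3 < Nat.card V ∧ ∀ S : Finset V, S.card ≤ 2 → (G.induce {v | v ∉ S}).Connected

/-- A rotation system on `G`, that is, an embedding of `G` into a closed oriented surface up to
homeomorphism: at every vertex, a cyclic order of the darts (directed edges) that start there.
`next d` is the successor of the dart `d` around its initial vertex. -/
structure RotationSystem {V : Type*} (G : SimpleGraph V) where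
  /-- The successor of a dart around its initial vertex. -/
  next : Equiv.Perm G.Dart
  fst_next : ∀ d : G.Dart, (next d).fst = d.fst
  sameCycle_of_fst_eq : ∀ d d' : G.Dart, d.fst = d'.fst → next.SameCycle d d'

namespace RotationSystem

variable {V : Type*} {G : SimpleGraph V} (R : RotationSystem G)

/-- The boundary walk: traverse the dart `d`, turn around at its end, and take the next dart
there. -/
def boundaryPerm : Equiv.Perm G.Dart where
  toFun d := R.next d.symm
  invFun d := (R.next.symm d).symm
  left_inv d := by simp
  right_inv d := by simp

/-- The faces of the embedding are the orbits of the boundary walk. -/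
def Face : Type _ := Quotient (Equiv.Perm.SameCycle.setoid R.boundaryPerm)

/-- The face whose boundary walk contains the dart `d`. -/
def faceOf (d : G.Dart) : R.Face := Quotient.mk _ d

/-- The face `F` is incident to the vertex `v`: its boundary walk passes through `v`. -/
def Incident (F : R.Face) (v : V) : Prop := ∃ d : G.Dart, d.fst = v ∧ R.faceOf d = F

instance [Finite V] : Finite R.Face := by
  have : Finite G.Dart := Finite.of_injective (fun d : G.Dart => d.toProd)
    (fun _ _ h => SimpleGraph.Dart.ext _ _ h)
  exact Quotient.finite _

instance [Finite V] : Fintype R.Face := Fintype.ofFinite _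

/-- The complex on the set of faces in which a nonempty set of faces is a simplex if and only
if all its members are incident to a common vertex. For a plane embedding of a 3-regular
three-connected graph, that is, the graph of a simple three-dimensional polytope `P`, this is
the boundary complex of the (simplicial) polytope dual to `P`. -/
def dualComplex : AbstractSimplicialComplex R.Face where
  faces := {S | S.Nonempty ∧ ∃ v : V, ∀ F ∈ S, R.Incident F v}
  isRelLowerSet_faces := by
    rintro S ⟨hS, v, hv⟩
    exact ⟨hS, fun T hT hne => ⟨hne, v, fun F hF => hv F (hT hF)⟩⟩
  singleton_mem := by
    intro F
    obtain ⟨d, rfl⟩ := Quotient.exists_rep F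
    refine ⟨Finset.singleton_nonempty _, d.fst, fun F hF => ?_⟩
    exact ⟨d, rfl, (Finset.mem_singleton.mp hF).symm⟩

end RotationSystem

/-- A planar embedding of a connected graph `G`, up to homeomorphism: a rotation system of
genus zero (that is, with the Euler characteristic `V - E + F = 2` of the sphere), together with
the choice of the face that is to be the outer one. -/
structure PlaneEmbedding {V : Type*} (G : SimpleGraph V) extends RotationSystem G where
  euler : Nat.card V + Nat.card toRotationSystem.Face = Nat.card G.edgeSet + 2
  /-- The outer (unbounded) face. -/
  outer : toRotationSystem.Face

/-! ### Stanley-Reisner generators -/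

/-- A minimal nonface of a simplicial complex. -/
def IsMinimalNonface {ι : Type*} (K : AbstractSimplicialComplex ι) (N : Finset ι) : Prop :=
  N.Nonempty ∧ N ∉ K.faces ∧ ∀ S, S ⊂ N → S.Nonempty → S ∈ K.faces

/-- The minimal monomial generators of the Stanley-Reisner ideal of `K`: the squarefree
monomials of the minimal nonfaces. -/
def stanleyReisnerGenerators (κ : Type*) [Field κ] {ι : Type*}
    (K : AbstractSimplicialComplex ι) : Set (MvPolynomial ι κ) :=
  {m | ∃ N : Finset ι, IsMinimalNonface K N ∧ m = ∏ F ∈ N, X F}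

/-! ### The schön embedding -/

namespace PlaneEmbedding

variable {V : Type*} {G : SimpleGraph V} (E : PlaneEmbedding G)

/-- The interior faces; they index the coordinates of projective space. -/
abbrev InteriorFace : Type _ := {F : E.Face // F ≠ E.outer}

instance [Finite V] : Fintype E.InteriorFace := Fintype.ofFinite _

/-- A vertex is exterior if it is incident to the outer face, and interior otherwise. -/
def IsExterior (v : V) : Prop := E.Incident E.outer v

open Classical in
/-- The ideal of the line of the vertex `v`: it is generated by the variables of the interior
faces not incident to `v` and, if `v` is an interior vertex, by the sum of the variables of the
faces incident to `v`. -/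
def lineIdeal (κ : Type*) [Field κ] [Finite V] (v : V) : Ideal (MvPolynomial E.InteriorFace κ) :=
  Ideal.span ({f | ∃ F : E.InteriorFace, ¬ E.Incident F.1 v ∧ f = X F} ∪
    {f | ¬ E.IsExterior v ∧ f = ∑ F : E.InteriorFace with E.Incident F.1 v, X F})

/-- The ideal of the schön embedding, that is, of the union of the lines of all vertices. -/
def schoenIdeal (κ : Type*) [Field κ] [Finite V] : Ideal (MvPolynomial E.InteriorFace κ) :=
  ⨅ v : V, E.lineIdeal κ v

open Classical in
/-- The substitution that replaces the variable of the outer face by minus the sum of all the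
other variables, and fixes the other variables. -/
def outerSubst (κ : Type*) [Field κ] [Finite V] :
    MvPolynomial E.Face κ →ₐ[κ] MvPolynomial E.InteriorFace κ :=
  aeval fun F => if h : F = E.outer then -∑ F' : E.InteriorFace, X F' else X ⟨F, h⟩

/-- The minimal Stanley-Reisner generators of the dual complex, after the substitution. -/
def schoenGenerators (κ : Type*) [Field κ] [Finite V] : Set (MvPolynomial E.InteriorFace κ) :=
  E.outerSubst κ '' stanleyReisnerGenerators κ E.dualComplex

end PlaneEmbedding

/-! ### Tropicalization into tropical projective space, for the trivial valuation -/

/-- Vectors with entries in `ℝ ∪ {∞}`, not all of them `∞`. -/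
abbrev HomogeneousCoords (ι : Type*) : Type _ := {w : ι → WithTop ℝ // ∃ i, w i ≠ ⊤}

/-- Two vectors are equivalent if they differ by the addition of a real number to all entries. -/
instance homogeneousSetoid (ι : Type*) : Setoid (HomogeneousCoords ι) where
  r w w' := ∃ c : ℝ, ∀ i, w'.1 i = (c : WithTop ℝ) + w.1 i
  iseqv := by
    refine ⟨fun w => ⟨0, fun i => by simp⟩, ?_, ?_⟩
    · rintro w w' ⟨c, hc⟩
      refine ⟨-c, fun i => ?_⟩
      rw [hc i, ← add_assoc, ← WithTop.coe_add]
      simp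
    · rintro w w' w'' ⟨c, hc⟩ ⟨c', hc'⟩
      refine ⟨c' + c, fun i => ?_⟩
      rw [hc' i, hc i, ← add_assoc, ← WithTop.coe_add]

/-- Tropical projective space, the quotient `((ℝ ∪ {∞})^ι ∖ {∞}) / ℝ (1, …, 1)`. -/
def TropicalProjectiveSpace (ι : Type*) : Type _ := Quotient (homogeneousSetoid ι)

/-- The quotient topology, where `ℝ ∪ {∞}` has the order topology. -/
instance (ι : Type*) : TopologicalSpace (TropicalProjectiveSpace ι) :=
  inferInstanceAs (TopologicalSpace (Quotient (homogeneousSetoid ι)))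

namespace TropicalProjectiveSpace

variable {ι : Type*}

/-- The point with given homogeneous coordinates. -/
def mk (w : HomogeneousCoords ι) : TropicalProjectiveSpace ι := Quotient.mk _ w

/-- The facet (coordinate hyperplane) at infinity where the `i`-th coordinate is `∞`. -/
def facet (i : ι) : Set (TropicalProjectiveSpace ι) := {p | ∃ w, w.1 i = ⊤ ∧ p = mk w}

end TropicalProjectiveSpace

open TropicalProjectiveSpace

section Tropicalization

variable {κ : Type*} [Field κ] {ι : Type*}

/-- The weight `w · α` of the exponent vector `α`. -/
def weight (w : ι → ℝ) (α : ι →₀ ℕ) : ℝ := α.sum fun i k => (k : ℝ) * w i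

/-- The minimum of the weights `w · α` over the exponents `α` of the terms of `f` is attained at
least twice. By convention this holds for `f = 0`. -/
def MinAttainedTwice (f : MvPolynomial ι κ) (w : ι → ℝ) : Prop :=
  f = 0 ∨ ∃ α ∈ f.support, ∃ β ∈ f.support, α ≠ β ∧ weight w α = weight w β ∧
    ∀ γ ∈ f.support, weight w α ≤ weight w γ

/-- The tropical hypersurface of a homogeneous polynomial in the tropical torus `ℝ^ι / ℝ 1`,
which is the part of tropical projective space where all coordinates are finite. It does not
change if `f` is multiplied by a monomial. -/
def torusHypersurface (f : MvPolynomial ι κ) : Set (TropicalProjectiveSpace ι) :=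
  {p | ∃ (w : ι → ℝ) (h : ∃ i, (w i : WithTop ℝ) ≠ ⊤),
    MinAttainedTwice f w ∧ p = mk ⟨fun i => (w i : WithTop ℝ), h⟩}

/-- The tropicalization of a homogeneous polynomial `f` into tropical projective space. Writing
`f = m * g` with a monomial `m` and a polynomial `g` without monomial factors, it is the union of
the (closure in tropical projective space of the) tropical hypersurface of `g`, which agrees with
that of `f` on the torus, and of the facets of the variables dividing `m`, which are the
variables dividing `f`. -/
def tropProj (f : MvPolynomial ι κ) : Set (TropicalProjectiveSpace ι) :=
  closure (torusHypersurface f) ∪ {p | ∃ i, X i ∣ f ∧ p ∈ facet i}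

/-- The tropicalization of a graded ideal: the intersection of the tropicalizations of its
homogeneous elements. -/
def tropProjIdeal (I : Ideal (MvPolynomial ι κ)) : Set (TropicalProjectiveSpace ι) :=
  {p | ∀ f ∈ I, (∃ n, f.IsHomogeneous n) → p ∈ tropProj f}

/-- A set `B` of homogeneous elements of the graded ideal `I` is a tropical basis if
the tropicalizations of the elements of `B` intersect in the tropicalization of `I`. -/
def IsTropicalBasis (B : Set (MvPolynomial ι κ)) (I : Ideal (MvPolynomial ι κ)) : Prop :=
  (∀ f ∈ B, f ∈ I ∧ ∃ n, f.IsHomogeneous n) ∧ ⋂ f ∈ B, tropProj f = tropProjIdeal I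

/-- `B` generates `I`, and no proper subset of `B` does. -/
def IsMinimalGeneratingSet (B : Set (MvPolynomial ι κ)) (I : Ideal (MvPolynomial ι κ)) : Prop :=
  Ideal.span B = I ∧ ∀ B', B' ⊂ B → Ideal.span B' ≠ I

end Tropicalization

end Schoen

end

noncomputable section

namespace Schoen

open TropicalProjectiveSpace

/-! ### Coordinate subspaces -/

section CoordinateIdeal

variable {κ : Type*} [Field κ] {σ : Type*}

/-! Before the substitution, each line is the coordinate subspace of the faces at a vertex, cut by
the hyperplane where the sum of all variables vanishes: `outerSubst` is the quotient by that sum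
(`ker_outerSubst`), and `lineIdeal_eq_map` identifies the images. The Stanley-Reisner ideal is the
intersection of the coordinate ideals, so generation says that this intersection commutes with
passing to the quotient. This holds because the subspaces are linked along the edges of the
connected graph, so the local multiples of the sum glue (`exists_sub_mul_sum_mem_iInf`). Minimality
follows by pulling back to the Stanley-Reisner ring, where the sum is a nonzerodivisor
(`prod_X_notMem_sup`).

For the tropical basis, take a point `w` in all the hypersurfaces of the generators. A nonface
without the outer face yields a monomial, which forces the finite coordinates of `w` to form a
simplex. If this simplex together with the outer face is again one, every element of the ideal
vanishes on the coordinate subspace of the finite coordinates. If not, a nonface containing the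
outer face yields the sum of the interior variables times a monomial, which forces the minimum of
`w` to be attained twice, and on that subspace every element of the ideal is a multiple of the sum
of the finite coordinates. In both cases the infinite coordinates are approximated by large real
ones (`mk_mem_tropProj_of_mem_coordIdeal`, `mk_mem_tropProj_of_mem_sup`). -/

/-- The ideal of the coordinate subspace spanned by the coordinates in `T`. -/
def coordIdeal (κ : Type*) [Field κ] (T : Set σ) : Ideal (MvPolynomial σ κ) :=
  Ideal.span (X '' Tᶜ)

open Classical in
/-- The restriction of polynomials to the coordinate subspace spanned by the coordinates in `T`. -/
def restrictTo (κ : Type*) [Field κ] (T : Set σ) : MvPolynomial σ κ →ₐ[κ] MvPolynomial σ κ :=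
  aeval fun i => if i ∈ T then X i else 0

theorem mem_coordIdeal {T : Set σ} {p : MvPolynomial σ κ} :
    p ∈ coordIdeal κ T ↔ ∀ m : σ →₀ ℕ, (m.support : Set σ) ⊆ T → coeff m p = 0 := by
  rw [coordIdeal, mem_ideal_span_X_image]
  refine forall_congr' fun m => ?_
  rw [mem_support_iff, Set.subset_def]
  simp only [Set.mem_compl_iff, Finset.mem_coe, Finsupp.mem_support_iff]
  constructor
  · intro h hm
    by_contra hc
    obtain ⟨i, hi, hmi⟩ := h hc
    exact hi (hm i hmi)
  · intro h hc
    by_contra! hn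
    exact hc (h fun i hi => by_contra fun hT => hi (hn i hT))

theorem X_mem_coordIdeal {T : Set σ} {i : σ} (hi : i ∉ T) : (X i : MvPolynomial σ κ) ∈ coordIdeal κ T :=
  Ideal.subset_span ⟨i, hi, rfl⟩

theorem coordIdeal_anti {S T : Set σ} (h : S ⊆ T) : coordIdeal κ T ≤ coordIdeal κ S :=
  Ideal.span_mono (Set.image_mono (Set.compl_subset_compl.mpr h))

open Classical in
theorem coeff_restrictTo (T : Set σ) (p : MvPolynomial σ κ) (m : σ →₀ ℕ) :
    coeff m (restrictTo κ T p) = if (m.support : Set σ) ⊆ T then coeff m p else 0 := by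
  induction p using MvPolynomial.induction_on' with
  | add p q hp hq => rw [map_add, coeff_add, hp, hq, coeff_add]; split_ifs <;> simp
  | monomial a c =>
    rw [restrictTo, aeval_monomial, algebraMap_eq]
    by_cases ha : (a.support : Set σ) ⊆ T
    · have : (a.prod fun i k => (if i ∈ T then (X i : MvPolynomial σ κ) else 0) ^ k)
          = a.prod fun i k => X i ^ k :=
        Finsupp.prod_congr fun i hi => by rw [if_pos (ha hi)]
      rw [this, ← monomial_eq, coeff_monomial]
      by_cases h : a = m
      · subst h; simp [ha]
      · simp [h]
    · obtain ⟨i, hi, hiT⟩ := Set.not_subset.mp ha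
      have : (a.prod fun i k => (if i ∈ T then (X i : MvPolynomial σ κ) else 0) ^ k) = 0 :=
        Finset.prod_eq_zero hi (by
          simp only [if_neg hiT]; exact zero_pow (Finsupp.mem_support_iff.mp hi))
      rw [this, mul_zero, coeff_zero, coeff_monomial]
      by_cases h : a = m
      · subst h; rw [if_neg ha]
      · simp [h]

theorem restrictTo_eq_zero {T : Set σ} {p : MvPolynomial σ κ} :
    restrictTo κ T p = 0 ↔ p ∈ coordIdeal κ T := by
  classical
  rw [mem_coordIdeal, MvPolynomial.ext_iff]
  refine forall_congr' fun m => ?_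
  rw [coeff_restrictTo, coeff_zero]
  split_ifs with h <;> simp [h]

theorem sub_restrictTo_mem (T : Set σ) (p : MvPolynomial σ κ) :
    p - restrictTo κ T p ∈ coordIdeal κ T := by
  classical
  rw [mem_coordIdeal]
  intro m hm
  rw [coeff_sub, coeff_restrictTo, if_pos hm, sub_self]

/-- The ideal is the kernel of a map into a domain. Primality is what allows the sum of the
variables to be cancelled below. -/
instance coordIdeal_isPrime (T : Set σ) : (coordIdeal κ T).IsPrime := by
  have : coordIdeal κ T = RingHom.ker (restrictTo κ T) := by
    ext p; rw [RingHom.mem_ker, restrictTo_eq_zero]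
  rw [this]
  exact RingHom.ker_isPrime (restrictTo κ T)

theorem coeff_single_sum_X (T : Finset σ) [DecidableEq σ] (i : σ) :
    coeff (Finsupp.single i 1) (∑ j ∈ T, (X j : MvPolynomial σ κ)) = if i ∈ T then 1 else 0 := by
  rw [coeff_sum]
  simp [coeff_X, Finsupp.single_left_inj]

theorem sum_X_notMem_coordIdeal {T : Set σ} {S : Finset σ} {i : σ} (hi : i ∈ T) (hiS : i ∈ S) :
    ∑ j ∈ S, (X j : MvPolynomial σ κ) ∉ coordIdeal κ T := by
  classical
  intro h
  have := mem_coordIdeal.mp h (Finsupp.single i 1) (by simp [hi])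
  rw [coeff_single_sum_X, if_pos hiS] at this
  exact one_ne_zero this

theorem X_dvd_iff_forall_coeff {i : σ} {p : MvPolynomial σ κ} :
    X i ∣ p ↔ ∀ m ∈ p.support, m i ≠ 0 := by
  rw [← Ideal.mem_span_singleton, ← Set.image_singleton, mem_ideal_span_X_image]
  simp

end CoordinateIdeal

/-! ### Stanley-Reisner ideals modulo the sum of the variables -/

section StanleyReisner

variable {κ : Type*} [Field κ] {σ : Type*} {V : Type*}

/-- Polynomials that vanish, modulo the sum of the variables, on every coordinate subspace of a
family that is connected through common coordinates vanish, up to a single multiple of the sum of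
the variables, on the whole family. -/
theorem exists_sub_mul_sum_mem_iInf [Fintype σ] [Finite V] (T : V → Set σ)
    (hconn : ∀ v w, Relation.ReflTransGen (fun v w => (T v ∩ T w).Nonempty) v w)
    (p : MvPolynomial σ κ)
    (hp : ∀ v, p ∈ coordIdeal κ (T v) ⊔ Ideal.span {∑ i, X i}) :
    ∃ h, p - (∑ i, X i) * h ∈ ⨅ v, coordIdeal κ (T v) := by
  classical
  have := Fintype.ofFinite V
  have hq : ∀ v, ∃ q, p - (∑ i, X i) * q ∈ coordIdeal κ (T v) := by
    intro v
    obtain ⟨a, ha, b, hb, hab⟩ := Submodule.mem_sup.mp (hp v)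
    obtain ⟨q, rfl⟩ := Ideal.mem_span_singleton'.mp hb
    refine ⟨q, ?_⟩
    rw [← hab]
    convert ha using 1
    ring
  choose q hq using hq
  -- On the common subspace the sum times `q v - q w` vanishes, and the sum does not lie in this
  -- prime ideal.
  have agree : ∀ v w, (T v ∩ T w).Nonempty → ∀ m : σ →₀ ℕ, (m.support : Set σ) ⊆ T v →
      (m.support : Set σ) ⊆ T w → coeff m (q v) = coeff m (q w) := by
    intro v w ⟨i, hi⟩ m hv hw
    have h1 : (∑ i, X i) * (q v - q w) ∈ coordIdeal κ (T v ∩ T w) := by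
      have := sub_mem (coordIdeal_anti Set.inter_subset_right (hq w))
        (coordIdeal_anti Set.inter_subset_left (hq v))
      convert this using 1
      ring
    have h2 := ((coordIdeal_isPrime _).mem_or_mem h1).resolve_left
      (sum_X_notMem_coordIdeal hi (Finset.mem_univ i))
    have := mem_coordIdeal.mp h2 m (Set.subset_inter hv hw)
    rwa [coeff_sub, sub_eq_zero] at this
  -- A nonconstant monomial supported in both sets provides a common coordinate itself. Only the
  -- constant term has to be carried along a chain of neighbours.
  have agree' : ∀ m v w, (m.support : Set σ) ⊆ T v → (m.support : Set σ) ⊆ T w →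
      coeff m (q v) = coeff m (q w) := by
    intro m v w hv hw
    rcases m.support.eq_empty_or_nonempty with h0 | ⟨i, hi⟩
    · induction hconn v w with
      | refl => rfl
      | tail _ h ih =>
        rw [ih (by simp [h0])]
        exact agree _ _ h m (by simp [h0]) (by simp [h0])
    · exact agree v w ⟨i, hv hi, hw hi⟩ m hv hw
  let c : (σ →₀ ℕ) → κ := fun m =>
    if h : ∃ v, (m.support : Set σ) ⊆ T v then coeff m (q h.choose) else 0
  have hc : ∀ m v, (m.support : Set σ) ⊆ T v → c m = coeff m (q v) := by
    intro m v hv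
    have h : ∃ v, (m.support : Set σ) ⊆ T v := ⟨v, hv⟩
    simp only [c, dif_pos h]
    exact agree' m _ _ h.choose_spec hv
  -- Restricting to the supports of the finitely many `q v` keeps the glued object a polynomial;
  -- elsewhere every local coefficient is zero.
  refine ⟨∑ m ∈ Finset.univ.biUnion fun v => (q v).support, monomial m (c m), ?_⟩
  rw [Submodule.mem_iInf]
  intro v
  have h1 : q v - ∑ m ∈ Finset.univ.biUnion fun v => (q v).support, monomial m (c m)
      ∈ coordIdeal κ (T v) := by
    rw [mem_coordIdeal]
    intro m hm
    rw [coeff_sub, coeff_sum]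
    simp only [coeff_monomial, Finset.sum_ite_eq']
    split_ifs with h
    · rw [hc m v hm, sub_self]
    · rw [sub_zero]
      by_contra hne
      exact h (Finset.mem_biUnion.mpr ⟨v, Finset.mem_univ _, mem_support_iff.mpr hne⟩)
  have := add_mem (hq v) (Ideal.mul_mem_left _ (∑ i, X i) h1)
  convert this using 1
  ring

theorem prod_X_eq_monomial {ι : Type*} (N : Finset ι) :
    (∏ i ∈ N, X i : MvPolynomial ι κ) = monomial (Finsupp.indicator N fun _ _ => 1) 1 := by
  simpa using prod_X_pow (R := κ) (fun _ => 1) N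

theorem indicator_one_le_iff {ι : Type*} {N : Finset ι} {m : ι →₀ ℕ} :
    (Finsupp.indicator N fun _ _ => 1) ≤ m ↔ N ⊆ m.support := by
  classical
  constructor
  · intro h i hi
    have := h i
    rw [Finsupp.indicator_of_mem hi] at this
    rw [Finsupp.mem_support_iff]; omega
  · intro h i
    by_cases hi : i ∈ N
    · rw [Finsupp.indicator_of_mem hi]
      exact Nat.one_le_iff_ne_zero.mpr (Finsupp.mem_support_iff.mp (h hi))
    · rw [Finsupp.indicator_of_notMem hi]; exact Nat.zero_le _

theorem support_indicator_one {ι : Type*} (N : Finset ι) :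
    (Finsupp.indicator N fun _ _ => 1 : ι →₀ ℕ).support = N := by
  classical
  ext i
  by_cases hi : i ∈ N <;> simp [Finsupp.indicator_apply, hi]

theorem mem_span_squarefree {ι : Type*} {S : Set (Finset ι)} {p : MvPolynomial ι κ} :
    p ∈ Ideal.span {f | ∃ N ∈ S, f = ∏ i ∈ N, X i} ↔
      ∀ m ∈ p.support, ∃ N ∈ S, N ⊆ m.support := by
  have : {f : MvPolynomial ι κ | ∃ N ∈ S, f = ∏ i ∈ N, X i} =
      (fun s => monomial s (1 : κ)) '' ((fun N => Finsupp.indicator N fun _ _ => 1) '' S) := by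
    ext f
    simp [prod_X_eq_monomial, eq_comm]
  rw [this, mem_ideal_span_monomial_image]
  simp only [Set.exists_mem_image, indicator_one_le_iff]

theorem exists_isMinimalNonface_subset {ι : Type*} {K : AbstractSimplicialComplex ι}
    {N : Finset ι} (hN : N.Nonempty) (hK : N ∉ K.faces) : ∃ N' ⊆ N, IsMinimalNonface K N' := by
  obtain ⟨N', hle, hmin⟩ := exists_minimal_le_of_wellFoundedLT
    (fun N : Finset ι => N.Nonempty ∧ N ∉ K.faces) N ⟨hN, hK⟩
  refine ⟨N', hle, hmin.prop.1, hmin.prop.2, fun S hS hne => ?_⟩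
  by_contra h
  exact hS.2 (hmin.le_of_le ⟨hne, h⟩ hS.1)

theorem IsMinimalNonface.eq_of_subset {ι : Type*} {K : AbstractSimplicialComplex ι}
    {N N' : Finset ι} (hN : IsMinimalNonface K N) (hN' : IsMinimalNonface K N') (h : N ⊆ N') :
    N = N' := by
  by_contra hne
  exact hN.2.1 (hN'.2.2 N (h.ssubset_of_ne hne) hN.1)

/-- The Stanley-Reisner ideal is the intersection of the ideals of the coordinate subspaces of the
facets. -/
theorem span_stanleyReisnerGenerators [Nonempty V] {K : AbstractSimplicialComplex σ}
    {T : V → Set σ}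
    (hK : ∀ S : Finset σ, S ∈ K.faces ↔ S.Nonempty ∧ ∃ v, (S : Set σ) ⊆ T v) :
    Ideal.span (stanleyReisnerGenerators κ K) = ⨅ v, coordIdeal κ (T v) := by
  ext p
  have : stanleyReisnerGenerators κ K =
      {f | ∃ N ∈ {N | IsMinimalNonface K N}, f = ∏ i ∈ N, X i} := rfl
  rw [this, mem_span_squarefree, Submodule.mem_iInf]
  simp only [mem_coordIdeal]
  constructor
  · intro h v m hm
    by_contra hc
    obtain ⟨N, hN, hNm⟩ := h m (mem_support_iff.mpr hc)
    exact hN.2.1 ((hK N).mpr ⟨hN.1, v, (Finset.coe_subset.mpr hNm).trans hm⟩)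
  · intro h m hm
    have hne : ∀ v, ¬ (m.support : Set σ) ⊆ T v := fun v hv =>
      mem_support_iff.mp hm (h v m hv)
    obtain ⟨N, hNm, hN⟩ := exists_isMinimalNonface_subset (K := K) (N := m.support)
      (by
        rw [Finset.nonempty_iff_ne_empty]
        intro h0
        exact hne (Classical.arbitrary V) (by simp [h0]))
      (fun hf => by
        obtain ⟨-, v, hv⟩ := (hK _).mp hf
        exact hne v hv)
    exact ⟨N, hN, hNm⟩

/-- A minimal generator of the Stanley-Reisner ideal is not in the ideal generated by the others
and the sum of the variables. -/
theorem prod_X_notMem_sup [Fintype σ] {K : AbstractSimplicialComplex σ} {T : V → Set σ}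
    (hT : ∀ v, (T v).Nonempty) [Nonempty V]
    (hK : ∀ S : Finset σ, S ∈ K.faces ↔ S.Nonempty ∧ ∃ v, (S : Set σ) ⊆ T v)
    {N : Finset σ} (hN : IsMinimalNonface K N) :
    (∏ i ∈ N, X i : MvPolynomial σ κ) ∉
      Ideal.span (stanleyReisnerGenerators κ K \ {∏ i ∈ N, X i}) ⊔ Ideal.span {∑ i, X i} := by
  classical
  intro hmem
  obtain ⟨j, hj, b, hb, hjb⟩ := Submodule.mem_sup.mp hmem
  obtain ⟨a, rfl⟩ := Ideal.mem_span_singleton'.mp hb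
  have hNSR : (∏ i ∈ N, X i : MvPolynomial σ κ) ∈ ⨅ v, coordIdeal κ (T v) := by
    rw [← span_stanleyReisnerGenerators hK]
    exact Ideal.subset_span ⟨N, hN, rfl⟩
  have hjSR : j ∈ ⨅ v, coordIdeal κ (T v) := by
    rw [← span_stanleyReisnerGenerators hK]
    exact Ideal.span_mono Set.sdiff_subset hj
  -- The multiple `a` of the sum lies in the Stanley-Reisner ideal, because the sum can be cancelled
  -- modulo each prime.
  have ha : ∀ v, a ∈ coordIdeal κ (T v) := by
    intro v
    obtain ⟨i, hi⟩ := hT v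
    have : a * ∑ i, X i ∈ coordIdeal κ (T v) := by
      have := sub_mem (Submodule.mem_iInf _ |>.mp hNSR v) (Submodule.mem_iInf _ |>.mp hjSR v)
      rwa [← hjb, add_sub_cancel_left] at this
    exact ((coordIdeal_isPrime _).mem_or_mem this).resolve_right
      (sum_X_notMem_coordIdeal hi (Finset.mem_univ i))
  set n : σ →₀ ℕ := Finsupp.indicator N fun _ _ => 1 with hn
  have hcoeff : coeff n (∏ i ∈ N, X i : MvPolynomial σ κ) = 1 := by
    rw [prod_X_eq_monomial, coeff_monomial, if_pos rfl]
  have hcj : coeff n j = 0 := by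
    by_contra hc
    have hsub : Ideal.span (stanleyReisnerGenerators κ K \ {∏ i ∈ N, X i}) ≤
        Ideal.span {f | ∃ N' ∈ {N' | IsMinimalNonface K N' ∧ N' ≠ N}, f = ∏ i ∈ N', X i} := by
      apply Ideal.span_mono
      rintro f ⟨⟨N', hN', rfl⟩, hne⟩
      refine ⟨N', ⟨hN', ?_⟩, rfl⟩
      rintro rfl
      exact hne rfl
    obtain ⟨N', ⟨hN', hne⟩, hsubs⟩ := mem_span_squarefree.mp (hsub hj) n (mem_support_iff.mpr hc)
    rw [hn, support_indicator_one] at hsubs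
    exact hne (hN'.eq_of_subset hN hsubs)
  -- A contribution to this coefficient comes from `N.erase i`, which is empty or a face, and `a`
  -- has no monomial supported on a face.
  have hca : coeff n (a * ∑ i, X i) = 0 := by
    rw [Finset.mul_sum, coeff_sum]
    refine Finset.sum_eq_zero fun i _ => ?_
    rw [coeff_mul_X']
    split_ifs with hi
    · rw [hn, support_indicator_one] at hi
      obtain ⟨v, hv⟩ : ∃ v, ((n - Finsupp.single i 1).support : Set σ) ⊆ T v := by
        have hs : (n - Finsupp.single i 1).support = N.erase i := by
          ext k
          by_cases hk : k = i
          · subst hk; simp [hn, Finsupp.indicator_apply, hi]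
          · simp [hn, Finsupp.indicator_apply, hk]
        rw [hs]
        rcases (N.erase i).eq_empty_or_nonempty with h0 | h0
        · exact ⟨Classical.arbitrary V, by simp [h0]⟩
        · exact ((hK _).mp (hN.2.2 _ (Finset.erase_ssubset hi) h0)).2
      exact mem_coordIdeal.mp (ha v) _ hv
    · rfl
  rw [← hjb, coeff_add, hcj, hca, add_zero] at hcoeff
  exact zero_ne_one hcoeff

end StanleyReisner

/-! ### Generators of the schön ideal -/

namespace RotationSystem

variable {V : Type*} {G : SimpleGraph V} (R : RotationSystem G)

/-- The faces incident to a vertex. -/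
def facesAt (v : V) : Set R.Face := {F | R.Incident F v}

theorem mem_dualComplex_faces (S : Finset R.Face) :
    S ∈ R.dualComplex.faces ↔ S.Nonempty ∧ ∃ v, (S : Set R.Face) ⊆ R.facesAt v :=
  Iff.rfl

/-- The next dart of the boundary walk starts where `d` ends and lies in the same orbit. -/
theorem incident_faceOf_snd (d : G.Dart) : R.Incident (R.faceOf d) d.snd := by
  refine ⟨R.boundaryPerm d, R.fst_next d.symm, Quotient.sound ?_⟩
  exact (Equiv.Perm.SameCycle.refl R.boundaryPerm d).apply_left

theorem facesAt_inter_nonempty {v w : V} (h : G.Adj v w) :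
    (R.facesAt v ∩ R.facesAt w).Nonempty :=
  ⟨R.faceOf ⟨(v, w), h⟩, ⟨⟨(v, w), h⟩, rfl, rfl⟩, R.incident_faceOf_snd ⟨(v, w), h⟩⟩

theorem facesAt_connected (hG : G.Connected) (v w : V) :
    Relation.ReflTransGen (fun v w => (R.facesAt v ∩ R.facesAt w).Nonempty) v w :=
  Relation.ReflTransGen.mono (fun _ _ h => R.facesAt_inter_nonempty h) _ _
    ((SimpleGraph.reachable_iff_reflTransGen v w).mp (hG v w))

theorem facesAt_nonempty {v w : V} (h : G.Adj v w) : (R.facesAt v).Nonempty :=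
  (R.facesAt_inter_nonempty h).mono Set.inter_subset_left

end RotationSystem

theorem IsThreeConnected.connected {V : Type*} {G : SimpleGraph V} (h : IsThreeConnected G) :
    G.Connected := by
  have h0 := h.2 ∅ (by simp)
  have : {v : V | v ∉ (∅ : Finset V)} = Set.univ := by ext; simp
  rw [this] at h0
  exact (SimpleGraph.induceUnivIso G).connected_iff.mp h0

namespace PlaneEmbedding

variable {κ : Type*} [Field κ] {V : Type*} [Finite V] {G : SimpleGraph V} (E : PlaneEmbedding G)

theorem outerSubst_X_outer : E.outerSubst κ (X E.outer) = -∑ F : E.InteriorFace, X F := by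
  simp [outerSubst]

theorem outerSubst_X_interior (F : E.InteriorFace) : E.outerSubst κ (X F.1) = X F := by
  simp [outerSubst, F.2]

theorem outerSubst_rename (p : MvPolynomial E.InteriorFace κ) :
    E.outerSubst κ (rename Subtype.val p) = p := by
  have : (E.outerSubst κ).comp (rename Subtype.val) = AlgHom.id κ _ := by
    ext F
    simp [outerSubst_X_interior]
  exact DFunLike.congr_fun this p

theorem outerSubst_surjective : Function.Surjective (E.outerSubst κ) :=
  fun p => ⟨_, E.outerSubst_rename p⟩

theorem sum_X_eq : (∑ F, X F : MvPolynomial E.Face κ) =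
    X E.outer + ∑ F : E.InteriorFace, X F.1 := by
  classical
  rw [Fintype.sum_eq_add_sum_subtype_ne _ E.outer]
  congr 1
  exact Finset.sum_congr (by ext; simp) fun _ _ => rfl

theorem outerSubst_sum_X : E.outerSubst κ (∑ F, X F) = 0 := by
  rw [sum_X_eq, map_add, map_sum, outerSubst_X_outer]
  simp [outerSubst_X_interior]

theorem ker_outerSubst : RingHom.ker (E.outerSubst κ) = Ideal.span {∑ F, X F} := by
  apply le_antisymm
  · intro p hp
    -- Renaming back is inverse to the substitution modulo the sum, so anything killed by the
    -- substitution is zero in the quotient.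
    have key : (Ideal.Quotient.mkₐ κ (Ideal.span {∑ F, X F})).comp
        ((rename Subtype.val).comp (E.outerSubst κ)) =
        Ideal.Quotient.mkₐ κ (Ideal.span {∑ F, (X F : MvPolynomial E.Face κ)}) := by
      ext F
      by_cases hF : F = E.outer
      · subst hF
        rw [AlgHom.comp_apply, AlgHom.comp_apply, outerSubst_X_outer, map_neg, map_sum]
        simp only [rename_X]
        rw [Ideal.Quotient.mkₐ_eq_mk, Ideal.Quotient.eq, ← neg_mem_iff, neg_sub, sub_neg_eq_add,
          ← sum_X_eq]
        exact Ideal.subset_span rfl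
      · rw [AlgHom.comp_apply, AlgHom.comp_apply, E.outerSubst_X_interior ⟨F, hF⟩, rename_X]
    have := DFunLike.congr_fun key p
    rw [AlgHom.comp_apply, AlgHom.comp_apply, RingHom.mem_ker.mp hp, map_zero, map_zero] at this
    exact Ideal.Quotient.eq_zero_iff_mem.mp this.symm
  · rw [Ideal.span_singleton_le_iff_mem]
    exact E.outerSubst_sum_X

theorem comap_map_outerSubst (I : Ideal (MvPolynomial E.Face κ)) :
    (I.map (E.outerSubst κ)).comap (E.outerSubst κ) = I ⊔ Ideal.span {∑ F, X F} := by
  rw [Ideal.comap_map_of_surjective (E.outerSubst κ) E.outerSubst_surjective, ← ker_outerSubst]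
  rfl

-- This exchanges the linear form of an interior vertex for the image of the outer variable, up to
-- sign.
open Classical in
theorem sum_X_sub_sum_incident_mem {v : V} {I : Ideal (MvPolynomial E.InteriorFace κ)}
    (hI : ∀ F : E.InteriorFace, ¬ E.Incident F.1 v → X F ∈ I) :
    ∑ F : E.InteriorFace, X F - ∑ F : E.InteriorFace with E.Incident F.1 v, X F ∈ I := by
  rw [← Finset.sum_filter_add_sum_filter_not Finset.univ
    (fun F : E.InteriorFace => E.Incident F.1 v), add_sub_cancel_left]
  exact sum_mem fun F hF => hI F (Finset.mem_filter.mp hF).2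

/-- The ideal of a line is the image of the ideal of a coordinate subspace. -/
theorem lineIdeal_eq_map (v : V) :
    E.lineIdeal κ v = (coordIdeal κ (E.facesAt v)).map (E.outerSubst κ) := by
  classical
  rw [coordIdeal, Ideal.map_span]
  apply le_antisymm
  · rw [lineIdeal, Ideal.span_le]
    have hX : ∀ F : E.InteriorFace, ¬ E.Incident F.1 v →
        X F ∈ Ideal.span (E.outerSubst κ '' (X '' (E.facesAt v)ᶜ)) := fun F hF =>
      Ideal.subset_span ⟨X F.1, ⟨F.1, hF, rfl⟩, E.outerSubst_X_interior F⟩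
    rintro f (⟨F, hF, rfl⟩ | ⟨hv, rfl⟩)
    · exact hX F hF
    · have h1 : -∑ F : E.InteriorFace, X F ∈
          Ideal.span (E.outerSubst κ '' (X '' (E.facesAt v)ᶜ)) :=
        Ideal.subset_span ⟨X E.outer, ⟨E.outer, hv, rfl⟩, E.outerSubst_X_outer⟩
      have := neg_mem (add_mem h1 (E.sum_X_sub_sum_incident_mem hX))
      rwa [neg_add, neg_neg, neg_sub, add_sub_cancel] at this
  · rw [Ideal.span_le]
    have hX : ∀ F : E.InteriorFace, ¬ E.Incident F.1 v → X F ∈ E.lineIdeal κ v := fun F hF =>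
      Ideal.subset_span (Or.inl ⟨F, hF, rfl⟩)
    rintro _ ⟨_, ⟨F, hF, rfl⟩, rfl⟩
    by_cases h : F = E.outer
    · subst h
      rw [outerSubst_X_outer]
      have h1 : ∑ F : E.InteriorFace with E.Incident F.1 v, X F ∈ E.lineIdeal κ v :=
        Ideal.subset_span (Or.inr ⟨hF, rfl⟩)
      have := neg_mem (add_mem h1 (E.sum_X_sub_sum_incident_mem hX))
      rwa [add_sub_cancel] at this
    · rw [E.outerSubst_X_interior ⟨F, h⟩]
      exact hX ⟨F, h⟩ hF

/-- The image of an intersection always lies in the intersection of the images; the converse is the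
gluing lemma. -/
theorem span_schoenGenerators (hG : G.Connected) :
    Ideal.span (E.schoenGenerators κ) = E.schoenIdeal κ := by
  have := hG.nonempty
  rw [schoenGenerators, ← Ideal.map_span,
    span_stanleyReisnerGenerators E.mem_dualComplex_faces, schoenIdeal]
  apply le_antisymm
  · refine le_iInf fun v => ?_
    rw [lineIdeal_eq_map]
    exact Ideal.map_mono (iInf_le _ v)
  · intro g hg
    rw [Submodule.mem_iInf] at hg
    obtain ⟨p, rfl⟩ := E.outerSubst_surjective g
    obtain ⟨h, hh⟩ := exists_sub_mul_sum_mem_iInf E.facesAt (E.facesAt_connected hG) p fun v => by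
      rw [← comap_map_outerSubst, Ideal.mem_comap, ← lineIdeal_eq_map]
      exact hg v
    have := Ideal.mem_map_of_mem (E.outerSubst κ) hh
    rwa [map_sub, map_mul, outerSubst_sum_X, zero_mul, sub_zero] at this

theorem isMinimalGeneratingSet_schoenGenerators (hG : G.Connected)
    (hdeg : ∀ v, ∃ w, G.Adj v w) :
    IsMinimalGeneratingSet (E.schoenGenerators κ) (E.schoenIdeal κ) := by
  have := hG.nonempty
  refine ⟨E.span_schoenGenerators hG, fun B hB hspan => ?_⟩
  obtain ⟨hsub, hnot⟩ := hB
  obtain ⟨_, ⟨_, ⟨N, hN, rfl⟩, rfl⟩, hNB⟩ := Set.not_subset.mp hnot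
  -- Discarding the one monomial suffices even if another monomial had the same image, since that
  -- image is not in `B`.
  have hle : B ⊆ E.outerSubst κ '' (stanleyReisnerGenerators κ E.dualComplex \ {∏ F ∈ N, X F}) := by
    intro g hg
    obtain ⟨m, hm, rfl⟩ := hsub hg
    refine ⟨m, ⟨hm, ?_⟩, rfl⟩
    rintro rfl
    exact hNB hg
  have hmem : E.outerSubst κ (∏ F ∈ N, X F) ∈
      (Ideal.span (stanleyReisnerGenerators κ E.dualComplex \ {∏ F ∈ N, X F})).map
        (E.outerSubst κ) := by
    rw [Ideal.map_span]
    apply Ideal.span_mono hle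
    rw [hspan, ← E.span_schoenGenerators hG]
    exact Ideal.subset_span ⟨_, ⟨N, hN, rfl⟩, rfl⟩
  rw [← Ideal.mem_comap, comap_map_outerSubst] at hmem
  exact prod_X_notMem_sup (fun v => E.facesAt_nonempty (hdeg v).choose_spec)
    E.mem_dualComplex_faces hN hmem

open Classical in
/-- The generator of a minimal nonface that does not contain the outer face. -/
theorem outerSubst_prod_of_notMem {N : Finset E.Face} (h : E.outer ∉ N) :
    E.outerSubst κ (∏ F ∈ N, X F) = ∏ F ∈ N.subtype (· ≠ E.outer), X F := by
  rw [map_prod, ← Finset.prod_subtype_of_mem (p := (· ≠ E.outer)) _ (by grind)]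
  exact Finset.prod_congr rfl fun F _ => E.outerSubst_X_interior F

open Classical in
/-- The generator of a minimal nonface that contains the outer face. -/
theorem outerSubst_prod_of_mem {N : Finset E.Face} (h : E.outer ∈ N) :
    E.outerSubst κ (∏ F ∈ N, X F) =
      -((∑ F, X F) * ∏ F ∈ N.subtype (· ≠ E.outer), X F) := by
  rw [← Finset.mul_prod_erase N _ h, map_mul, outerSubst_X_outer,
    outerSubst_prod_of_notMem E (Finset.notMem_erase _ _), neg_mul]
  congr 3
  ext F
  simp [F.2]

theorem isHomogeneous_of_mem_schoenGenerators {g : MvPolynomial E.InteriorFace κ}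
    (hg : g ∈ E.schoenGenerators κ) : ∃ n, g.IsHomogeneous n := by
  classical
  obtain ⟨_, ⟨N, -, rfl⟩, rfl⟩ := hg
  refine ⟨∑ F ∈ N, 1, ?_⟩
  rw [map_prod]
  refine IsHomogeneous.prod _ _ _ fun F _ => ?_
  by_cases h : F = E.outer
  · subst h
    rw [outerSubst_X_outer]
    exact (IsHomogeneous.sum _ _ _ fun F _ => isHomogeneous_X κ F).neg
  · rw [E.outerSubst_X_interior ⟨F, h⟩]
    exact isHomogeneous_X κ _

end PlaneEmbedding

/-! ### Tropical hypersurfaces -/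

section Weight

variable {κ : Type*} [Field κ] {ι : Type*}

theorem weight_add (w : ι → ℝ) (α β : ι →₀ ℕ) : weight w (α + β) = weight w α + weight w β :=
  Finsupp.sum_add_index' (by simp) (by intro i a b; push_cast; ring)

theorem weight_single (w : ι → ℝ) (i : ι) : weight w (Finsupp.single i 1) = w i := by
  simp [weight]

theorem weight_add_smul (u v : ι → ℝ) (t : ℝ) (α : ι →₀ ℕ) :
    weight (fun i => u i + t * v i) α = weight u α + t * weight v α := by
  simp only [weight, Finsupp.sum, Finset.mul_sum, ← Finset.sum_add_distrib]
  exact Finset.sum_congr rfl fun i _ => by ring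

theorem weight_indicator_eq_zero {S : Set ι} {α : ι →₀ ℕ} (h : (α.support : Set ι) ⊆ S) :
    weight (Sᶜ.indicator 1) α = 0 := by
  refine Finset.sum_eq_zero fun i hi => ?_
  simp only [Set.indicator_of_notMem (show i ∉ Sᶜ from not_not.mpr (h hi)), mul_zero]

theorem one_le_weight_indicator {S : Set ι} {α : ι →₀ ℕ} (h : ¬ (α.support : Set ι) ⊆ S) :
    1 ≤ weight (Sᶜ.indicator 1) α := by
  obtain ⟨i, hi, hiS⟩ := Set.not_subset.mp h
  have hnn : ∀ j ∈ α.support, 0 ≤ (α j : ℝ) * Sᶜ.indicator 1 j := fun j _ =>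
    mul_nonneg (Nat.cast_nonneg _) (Set.indicator_nonneg (fun _ _ => zero_le_one) _)
  refine le_trans ?_ (Finset.single_le_sum hnn hi)
  rw [Set.indicator_of_mem (by simpa using hiS), Pi.one_apply, mul_one]
  exact_mod_cast Nat.one_le_iff_ne_zero.mpr (Finsupp.mem_support_iff.mp hi)

theorem weight_indicator_singleton (i : ι) (α : ι →₀ ℕ) :
    weight (({i} : Set ι).indicator 1) α = α i := by
  classical
  rw [weight, Finsupp.sum]
  simp only [Set.indicator_apply, Set.mem_singleton_iff, Pi.one_apply, mul_ite, mul_one, mul_zero]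
  rw [Finset.sum_ite_eq']
  split_ifs with h
  · rfl
  · rw [Finsupp.notMem_support_iff.mp h, Nat.cast_zero]

/-- Ties of minimal weight are broken in favour of `a`, so that the product of this term with `X a`
cannot cancel. -/
theorem exists_leading_exponent {h : MvPolynomial ι κ} (hh : h ≠ 0) (w : ι → ℝ) (a : ι) :
    ∃ α ∈ h.support, (∀ γ ∈ h.support, weight w α ≤ weight w γ) ∧
      ∀ γ ∈ h.support, weight w γ ≤ weight w α → γ a ≤ α a := by
  classical
  obtain ⟨α₀, hα₀, hmin⟩ := Finset.exists_min_image h.support (weight w)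
    (support_nonempty.mpr hh)
  obtain ⟨α, hα, hmax⟩ := Finset.exists_max_image
    (h.support.filter fun γ => weight w γ ≤ weight w α₀) (fun γ => γ a)
    ⟨α₀, Finset.mem_filter.mpr ⟨hα₀, le_rfl⟩⟩
  rw [Finset.mem_filter] at hα
  exact ⟨α, hα.1, fun γ hγ => hα.2.trans (hmin γ hγ), fun γ hγ hle =>
    hmax γ (Finset.mem_filter.mpr ⟨hγ, hle.trans hα.2⟩)⟩

theorem coeff_sum_X_mul [DecidableEq ι] (T : Finset ι) (h : MvPolynomial ι κ) (m : ι →₀ ℕ) :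
    coeff m ((∑ i ∈ T, X i) * h) =
      ∑ i ∈ T, if i ∈ m.support then coeff (m - Finsupp.single i 1) h else 0 := by
  rw [Finset.sum_mul, coeff_sum]
  exact Finset.sum_congr rfl fun i _ => coeff_X_mul' _ _ _

/-- A competing product with `X i` would come from a term of no larger weight than `α` but with one
more factor `X a`. -/
theorem coeff_leading_mul_sum_X {h : MvPolynomial ι κ} {w : ι → ℝ} {T : Finset ι} {a : ι}
    (ha : a ∈ T) (hw : ∀ i ∈ T, w a ≤ w i) {α : ι →₀ ℕ}
    (hmax : ∀ γ ∈ h.support, weight w γ ≤ weight w α → γ a ≤ α a) :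
    coeff (α + Finsupp.single a 1) ((∑ i ∈ T, X i) * h) = coeff α h := by
  classical
  rw [coeff_sum_X_mul, Finset.sum_eq_single_of_mem a ha]
  · rw [if_pos (by simp), add_tsub_cancel_right]
  · intro i hi hia
    split_ifs with his
    · by_contra hc
      set γ := α + Finsupp.single a 1 - Finsupp.single i 1 with hγ
      have hadd : γ + Finsupp.single i 1 = α + Finsupp.single a 1 := by
        apply tsub_add_cancel_of_le
        rw [Finsupp.single_le_iff]
        exact Nat.one_le_iff_ne_zero.mpr (Finsupp.mem_support_iff.mp his)
      have hwt := congrArg (weight w) hadd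
      rw [weight_add, weight_add, weight_single, weight_single] at hwt
      have hle := hmax γ (mem_support_iff.mpr hc) (by linarith [hw i hi])
      have := DFunLike.congr_fun hadd a
      simp [hia] at this
      omega
    · rfl

/-- A nonzero multiple of a sum of variables that attains the minimum of its weights at two
variables attains the minimum twice. -/
theorem minAttainedTwice_sum_X_mul {h : MvPolynomial ι κ} (hh : h ≠ 0) {w : ι → ℝ} {T : Finset ι}
    {a b : ι} (ha : a ∈ T) (hb : b ∈ T) (hab : a ≠ b) (heq : w a = w b)
    (hw : ∀ i ∈ T, w a ≤ w i) : MinAttainedTwice ((∑ i ∈ T, X i) * h) w := by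
  classical
  obtain ⟨α, hα, hαmin, hαmax⟩ := exists_leading_exponent hh w a
  obtain ⟨β, hβ, hβmin, hβmax⟩ := exists_leading_exponent hh w b
  have hαβ : weight w α = weight w β := le_antisymm (hαmin β hβ) (hβmin α hα)
  refine Or.inr ⟨α + Finsupp.single a 1, ?_, β + Finsupp.single b 1, ?_, ?_, ?_, ?_⟩
  · rw [mem_support_iff, coeff_leading_mul_sum_X ha hw hαmax]
    exact mem_support_iff.mp hα
  · rw [mem_support_iff, coeff_leading_mul_sum_X hb (by rwa [← heq]) hβmax]
    exact mem_support_iff.mp hβ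
  -- If the two products agreed, `α` would contain one more `b` than `β`, against the tie-breaking
  -- for `β`.
  · intro hc
    have h1 := DFunLike.congr_fun hc b
    have h2 := hβmax α hα hαβ.le
    simp [hab] at h1
    omega
  · rw [weight_add, weight_add, weight_single, weight_single, hαβ, heq]
  · intro γ hγ
    rw [mem_support_iff, coeff_sum_X_mul] at hγ
    obtain ⟨i, hi, hne⟩ := Finset.exists_ne_zero_of_sum_ne_zero hγ
    split_ifs at hne with his
    · have hadd : γ - Finsupp.single i 1 + Finsupp.single i 1 = γ := by
        apply tsub_add_cancel_of_le
        rw [Finsupp.single_le_iff]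
        exact Nat.one_le_iff_ne_zero.mpr (Finsupp.mem_support_iff.mp his)
      rw [← hadd, weight_add, weight_add, weight_single, weight_single]
      exact add_le_add (hαmin _ (mem_support_iff.mpr hne)) (hw i hi)
    · exact absurd rfl hne

/-- The terms of `r` are too heavy to cancel a term of `g` or to undercut its minimum. -/
theorem MinAttainedTwice.add {g r : MvPolynomial ι κ} {w : ι → ℝ} (hg : MinAttainedTwice g w)
    (hg0 : g ≠ 0) (hr : ∀ α ∈ g.support, ∀ γ ∈ r.support, weight w α < weight w γ) :
    MinAttainedTwice (g + r) w := by
  classical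
  obtain ⟨α, hα, β, hβ, hne, heq, hmin⟩ := hg.resolve_left hg0
  have hsupp : ∀ δ ∈ g.support, δ ∈ (g + r).support := by
    intro δ hδ
    have : δ ∉ r.support := fun h => lt_irrefl _ (hr δ hδ δ h)
    rw [mem_support_iff, coeff_add, notMem_support_iff.mp this, add_zero]
    exact mem_support_iff.mp hδ
  refine Or.inr ⟨α, hsupp α hα, β, hsupp β hβ, hne, heq, fun γ hγ => ?_⟩
  rcases Finset.mem_union.mp (support_add hγ) with h | h
  · exact hmin γ h
  · exact (hr α hα γ h).le

/-- If no variable outside `S` divides `f`, but every term of `f` is divisible by such a variable,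
then the coordinates outside `S` can be increased until the minimum is attained twice. -/
theorem exists_minAttainedTwice_of_mem_coordIdeal {f : MvPolynomial ι κ} (hf : f ≠ 0) {S : Set ι}
    (hfS : f ∈ coordIdeal κ S) (hdvd : ∀ i ∉ S, ¬ X i ∣ f) (w : ι → ℝ) :
    ∃ w', MinAttainedTwice f w' ∧ (∀ i ∈ S, w' i = w i) ∧ ∀ i, w i ≤ w' i := by
  classical
  obtain ⟨α, hα, hαmin⟩ := Finset.exists_min_image f.support (weight w) (support_nonempty.mpr hf)
  obtain ⟨i, hi, hiS⟩ := Set.not_subset.mp fun h =>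
    mem_support_iff.mp hα (mem_coordIdeal.mp hfS α h)
  have hαi : α i ≠ 0 := Finsupp.mem_support_iff.mp hi
  have hβ : ∃ β ∈ f.support, β i = 0 := by
    by_contra! h
    exact hdvd i hiS (X_dvd_iff_forall_coeff.mpr h)
  obtain ⟨β₀, hβ₀, hβ₀i⟩ := hβ
  obtain ⟨β, hβ, hβmin⟩ := Finset.exists_min_image (f.support.filter fun γ => γ i = 0) (weight w)
    ⟨β₀, Finset.mem_filter.mpr ⟨hβ₀, hβ₀i⟩⟩
  obtain ⟨δ, hδ, hδmax⟩ := Finset.exists_max_image (f.support.filter fun γ => γ i ≠ 0)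
    (fun γ => (weight w β - weight w γ) / γ i) ⟨α, Finset.mem_filter.mpr ⟨hα, hαi⟩⟩
  rw [Finset.mem_filter] at hβ hδ
  -- The least increase of the coordinate `i` at which every term containing `X i` weighs at least
  -- as much as `β`, the lightest term without it; `δ` then ties with `β`.
  set t := (weight w β - weight w δ) / δ i with ht
  have ht0 : 0 ≤ t := by
    refine le_trans ?_ (hδmax α (Finset.mem_filter.mpr ⟨hα, hαi⟩))
    exact div_nonneg (sub_nonneg.mpr (hαmin β hβ.1)) (Nat.cast_nonneg _)
  have hwt : ∀ γ, weight (fun j => w j + t * ({i} : Set ι).indicator 1 j) γ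
      = weight w γ + t * γ i := fun γ => by
    rw [weight_add_smul, weight_indicator_singleton]
  have hδt : weight w δ + t * δ i = weight w β := by
    have : (δ i : ℝ) ≠ 0 := Nat.cast_ne_zero.mpr hδ.2
    rw [ht]
    field_simp
    ring
  refine ⟨fun j => w j + t * ({i} : Set ι).indicator 1 j, Or.inr ⟨δ, hδ.1, β, hβ.1, ?_, ?_, ?_⟩,
    fun j hj => ?_, fun j => ?_⟩
  · rintro rfl
    exact hδ.2 hβ.2
  · rw [hwt, hwt, hδt, hβ.2]
    simp
  · intro γ hγ
    rw [hwt, hwt, hδt]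
    by_cases hγi : γ i = 0
    · rw [hγi]
      simpa using hβmin γ (Finset.mem_filter.mpr ⟨hγ, hγi⟩)
    · have h1 := hδmax γ (Finset.mem_filter.mpr ⟨hγ, hγi⟩)
      have hpos : (0 : ℝ) < γ i := by exact_mod_cast Nat.pos_of_ne_zero hγi
      rw [div_le_iff₀ hpos] at h1
      linarith
  · have : j ≠ i := by rintro rfl; exact hiS hj
    simp [this]
  · have : 0 ≤ ({i} : Set ι).indicator (1 : ι → ℝ) j :=
      Set.indicator_nonneg (fun _ _ => zero_le_one) _
    nlinarith

end Weight

/-! ### Closures in tropical projective space -/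

section Closure

variable {κ : Type*} [Field κ] {ι : Type*}

theorem continuous_mk : Continuous (mk : HomogeneousCoords ι → TropicalProjectiveSpace ι) :=
  continuous_quotient_mk'

theorem mk_mem_facet {w : HomogeneousCoords ι} {i : ι} : mk w ∈ facet i ↔ w.1 i = ⊤ := by
  constructor
  · rintro ⟨w', hw', h⟩
    obtain ⟨c, hc⟩ := Quotient.exact h
    have := hc i
    rw [hw'] at this
    by_contra hne
    exact WithTop.add_ne_top.mpr ⟨WithTop.coe_ne_top, hne⟩ this.symm
  · exact fun h => ⟨w, h, rfl⟩

/-- The point with given finite homogeneous coordinates. -/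
def mkFinite [Nonempty ι] (w : ι → ℝ) : TropicalProjectiveSpace ι :=
  mk ⟨fun i => (w i : WithTop ℝ), Classical.arbitrary ι, WithTop.coe_ne_top⟩

theorem mem_closure_torusHypersurface {f : MvPolynomial ι κ} {w : HomogeneousCoords ι}
    (u : ℝ → ι → ℝ) (hu : ∀ᶠ t in Filter.atTop, MinAttainedTwice f (u t))
    (hlim : ∀ i, Filter.Tendsto (fun t => (u t i : WithTop ℝ)) Filter.atTop (nhds (w.1 i))) :
    mk w ∈ closure (torusHypersurface f) := by
  obtain ⟨i₀, -⟩ := id w.2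
  have : Nonempty ι := ⟨i₀⟩
  refine mem_closure_of_tendsto (f := fun t => mkFinite (u t)) (b := Filter.atTop) ?_ ?_
  · refine (continuous_mk.tendsto w).comp ?_
    rw [tendsto_subtype_rng, tendsto_pi_nhds]
    exact hlim
  · filter_upwards [hu] with t ht
    exact ⟨u t, _, ht, rfl⟩

/-- The coordinates of a point, with the infinite ones replaced by `t`. -/
def truncate (w : ι → WithTop ℝ) (t : ℝ) (i : ι) : ℝ := (w i).untopD t

theorem truncate_of_eq_top {w : ι → WithTop ℝ} {i : ι} (h : w i = ⊤) (t : ℝ) :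
    truncate w t i = t := by
  simp [truncate, h]

theorem coe_truncate {w : ι → WithTop ℝ} {i : ι} (h : w i ≠ ⊤) (t : ℝ) :
    (truncate w t i : WithTop ℝ) = w i := by
  obtain ⟨x, hx⟩ := WithTop.ne_top_iff_exists.mp h
  simp [truncate, ← hx]

theorem truncate_eq (w : ι → WithTop ℝ) (t : ℝ) :
    truncate w t = fun i => truncate w 0 i + t * {i | w i ≠ ⊤}ᶜ.indicator 1 i := by
  classical
  funext i
  by_cases h : w i = ⊤
  · simp [truncate_of_eq_top h, h]
  · rw [← WithTop.coe_inj, coe_truncate h, Set.indicator_of_notMem (by simpa using h), mul_zero,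
      add_zero, coe_truncate h]

/-- At an infinite coordinate only the lower bound by `t` matters, which leaves room to raise such
coordinates further. -/
theorem tendsto_of_le_truncate {w : ι → WithTop ℝ} {u : ℝ → ι → ℝ}
    (h : ∀ t i, w i ≠ ⊤ → u t i = truncate w t i) (h' : ∀ t i, truncate w t i ≤ u t i) (i : ι) :
    Filter.Tendsto (fun t => (u t i : WithTop ℝ)) Filter.atTop (nhds (w i)) := by
  by_cases hi : w i = ⊤
  · rw [hi]
    refine tendsto_nhds_top_mono WithTop.tendsto_coe_atTop (Filter.Eventually.of_forall fun t => ?_)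
    exact WithTop.coe_le_coe.mpr ((truncate_of_eq_top hi t).symm.trans_le (h' t i))
  · refine tendsto_const_nhds.congr fun t => ?_
    rw [h t i hi, coe_truncate hi]

/-- A polynomial that vanishes where the infinite coordinates do. -/
theorem mk_mem_tropProj_of_mem_coordIdeal {f : MvPolynomial ι κ} {w : HomogeneousCoords ι}
    (hf : f ∈ coordIdeal κ {i | w.1 i ≠ ⊤}) : mk w ∈ tropProj f := by
  by_cases hd : ∃ i, X i ∣ f ∧ w.1 i = ⊤
  · obtain ⟨i, hi, hw⟩ := hd
    exact Or.inr ⟨i, hi, mk_mem_facet.mpr hw⟩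
  · push Not at hd
    refine Or.inl ?_
    have key : ∀ t, ∃ u, MinAttainedTwice f u ∧
        (∀ i ∈ {i | w.1 i ≠ ⊤}, u i = truncate w.1 t i) ∧ ∀ i, truncate w.1 t i ≤ u i := by
      intro t
      by_cases hf0 : f = 0
      · exact ⟨truncate w.1 t, Or.inl hf0, fun _ _ => rfl, fun _ => le_rfl⟩
      · exact exists_minAttainedTwice_of_mem_coordIdeal hf0 hf
          (fun i hi hdi => hi (hd i hdi)) _
    choose u hu h1 h2 using key
    exact mem_closure_torusHypersurface u (Filter.Eventually.of_forall hu)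
      (tendsto_of_le_truncate h1 h2)

/-- A polynomial that, restricted to the finite coordinates, is a multiple of a sum of variables
whose tropical hyperplane contains the point. -/
theorem mk_mem_tropProj_of_mem_sup {f : MvPolynomial ι κ} {w : HomogeneousCoords ι} {T : Finset ι}
    (hT : (T : Set ι) ⊆ {i | w.1 i ≠ ⊤}) {a b : ι} (ha : a ∈ T) (hb : b ∈ T) (hab : a ≠ b)
    (heq : w.1 a = w.1 b) (hw : ∀ i ∈ T, w.1 a ≤ w.1 i)
    (hf : f ∈ coordIdeal κ {i | w.1 i ≠ ⊤} ⊔ Ideal.span {∑ i ∈ T, X i}) :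
    mk w ∈ tropProj f := by
  classical
  set S : Set ι := {i | w.1 i ≠ ⊤} with hS
  obtain ⟨r₀, hr₀, _, hq, hsum⟩ := Submodule.mem_sup.mp hf
  obtain ⟨h, rfl⟩ := Ideal.mem_span_singleton'.mp hq
  -- Restricting the cofactor keeps `g` in the finite variables, so every term left in `r` contains
  -- an infinite one.
  set g := (∑ i ∈ T, X i) * restrictTo κ S h with hg
  set r := f - g with hrdef
  have hr : r ∈ coordIdeal κ S := by
    have := add_mem hr₀ (Ideal.mul_mem_left _ (∑ i ∈ T, X i) (sub_restrictTo_mem S h))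
    convert this using 1
    rw [hrdef, hg, ← hsum]
    ring
  have hfgr : f = g + r := by rw [hrdef]; ring
  by_cases hh : restrictTo κ S h = 0
  · refine mk_mem_tropProj_of_mem_coordIdeal ?_
    rw [hfgr, hg, hh, mul_zero, zero_add]
    exact hr
  refine Or.inl (mem_closure_torusHypersurface (truncate w.1) ?_
    (tendsto_of_le_truncate (fun _ _ _ => rfl) fun _ _ => le_rfl))
  have hfin : ∀ i ∈ T, ∀ t, (truncate w.1 t i : WithTop ℝ) = w.1 i := fun i hi t =>
    coe_truncate (hT hi) t
  have hgmin : ∀ t, MinAttainedTwice g (truncate w.1 t) := fun t =>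
    minAttainedTwice_sum_X_mul hh ha hb hab
      (by rw [← WithTop.coe_inj, hfin a ha, hfin b hb, heq])
      (fun i hi => by rw [← WithTop.coe_le_coe, hfin a ha, hfin i hi]; exact hw i hi)
  have hg0 : g ≠ 0 := by
    refine mul_ne_zero ?_ hh
    intro h0
    exact sum_X_notMem_coordIdeal (κ := κ) (T := Set.univ) (Set.mem_univ a) ha (h0 ▸ zero_mem _)
  have hgS : ∀ α ∈ g.support, (α.support : Set ι) ⊆ S := by
    intro α hα i hi
    rw [mem_support_iff, coeff_sum_X_mul] at hα
    obtain ⟨j, hj, hne⟩ := Finset.exists_ne_zero_of_sum_ne_zero hα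
    split_ifs at hne with hjα
    · rw [coeff_restrictTo] at hne
      split_ifs at hne with hsub
      · by_cases hij : i = j
        · subst hij; exact hT hj
        · refine hsub ?_
          simpa [Finsupp.single_apply, Ne.symm hij] using hi
      · exact absurd rfl hne
    · exact absurd rfl hne
  have hrS : ∀ γ ∈ r.support, ¬ (γ.support : Set ι) ⊆ S := fun γ hγ hsub =>
    mem_support_iff.mp hγ (mem_coordIdeal.mp hr γ hsub)
  -- The weights of `g` do not depend on `t`, while those of `r` grow at least like `t`.
  have hlt : ∀ α ∈ g.support, ∀ γ ∈ r.support, ∀ᶠ t in Filter.atTop,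
      weight (truncate w.1 t) α < weight (truncate w.1 t) γ := by
    intro α hα γ hγ
    filter_upwards [Filter.eventually_gt_atTop
      (max 0 (weight (truncate w.1 0) α - weight (truncate w.1 0) γ))] with t ht
    rw [truncate_eq, weight_add_smul, weight_add_smul, weight_indicator_eq_zero (hgS α hα)]
    have h1 := one_le_weight_indicator (hrS γ hγ)
    have h2 := (le_max_left _ _).trans_lt ht
    have h3 := (le_max_right _ _).trans_lt ht
    nlinarith
  have hall : ∀ᶠ t in Filter.atTop, ∀ α ∈ g.support, ∀ γ ∈ r.support,
      weight (truncate w.1 t) α < weight (truncate w.1 t) γ :=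
    (Filter.eventually_all_finset _).mpr fun α hα =>
      (Filter.eventually_all_finset _).mpr fun γ hγ => hlt α hα γ hγ
  filter_upwards [hall] with t ht
  rw [hfgr]
  exact (hgmin t).add hg0 ht

theorem torusHypersurface_prod_X (N : Finset ι) :
    torusHypersurface (∏ i ∈ N, X i : MvPolynomial ι κ) = ∅ := by
  rw [Set.eq_empty_iff_forall_notMem]
  rintro _ ⟨w, _, hw, -⟩
  rw [prod_X_eq_monomial] at hw
  rcases hw with h0 | ⟨α, hα, β, hβ, hne, -⟩
  · simp at h0
  · have h1 := Finset.mem_singleton.mp (support_monomial_subset hα)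
    have h2 := Finset.mem_singleton.mp (support_monomial_subset hβ)
    exact hne (h1.trans h2.symm)

theorem X_dvd_prod_X {N : Finset ι} {i : ι} (h : X i ∣ (∏ j ∈ N, X j : MvPolynomial ι κ)) :
    i ∈ N := by
  obtain ⟨j, hj, hij⟩ := (X_prime.dvd_finsetProd_iff _).mp h
  rw [X_dvd_X] at hij
  exact hij ▸ hj

/-- A single term never attains its minimum twice, so only the facets remain. -/
theorem exists_eq_top_of_mem_tropProj_prod_X {N : Finset ι} {w : HomogeneousCoords ι}
    (h : mk w ∈ tropProj (∏ i ∈ N, X i : MvPolynomial ι κ)) : ∃ i ∈ N, w.1 i = ⊤ := by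
  rcases h with h | ⟨i, hi, hw⟩
  · rw [torusHypersurface_prod_X, closure_empty] at h
    exact h.elim
  · exact ⟨i, X_dvd_prod_X hi, mk_mem_facet.mp hw⟩

variable [Fintype ι]

/-- The points whose minimal coordinate is attained at least twice form a closed set. -/
theorem isClosed_setOf_min_attained_twice : IsClosed {p : TropicalProjectiveSpace ι |
    ∃ w, p = mk w ∧ ∃ a b, a ≠ b ∧ w.1 a = w.1 b ∧ ∀ i, w.1 a ≤ w.1 i} := by
  have hq : Topology.IsQuotientMap (mk : HomogeneousCoords ι → TropicalProjectiveSpace ι) :=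
    isQuotientMap_quotient_mk'
  rw [← hq.isClosed_preimage]
  have : mk ⁻¹' {p : TropicalProjectiveSpace ι |
      ∃ w, p = mk w ∧ ∃ a b, a ≠ b ∧ w.1 a = w.1 b ∧ ∀ i, w.1 a ≤ w.1 i} =
      ⋃ a : ι, ⋃ b : ι, ⋃ _ : a ≠ b,
        {w : HomogeneousCoords ι | w.1 a = w.1 b} ∩ ⋂ i, {w | w.1 a ≤ w.1 i} := by
    ext w
    simp only [Set.mem_preimage, Set.mem_ofPred_eq, Set.mem_iUnion, Set.mem_inter_iff,
      Set.mem_iInter, exists_prop]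
    constructor
    · rintro ⟨w', h, a, b, hab, heq, hmin⟩
      obtain ⟨c, hc⟩ := Quotient.exact h.symm
      refine ⟨a, b, hab, by rw [hc, hc, heq], fun i => ?_⟩
      rw [hc, hc]
      gcongr
      exact hmin i
    · rintro ⟨a, b, h⟩
      exact ⟨w, rfl, a, b, h⟩
  rw [this]
  have hc : ∀ i : ι, Continuous fun w : HomogeneousCoords ι => w.1 i := fun i =>
    (continuous_apply i).comp continuous_subtype_val
  refine isClosed_iUnion_of_finite fun a => isClosed_iUnion_of_finite fun b =>
    isClosed_iUnion_of_finite fun _ => ?_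
  exact (isClosed_eq (hc a) (hc b)).inter (isClosed_iInter fun i => isClosed_le (hc a) (hc i))

theorem support_sum_X_mul_prod_X [DecidableEq ι] (N : Finset ι) (m : ι →₀ ℕ) :
    m ∈ ((∑ i, X i) * ∏ i ∈ N, X i : MvPolynomial ι κ).support ↔
      ∃ i, m = Finsupp.single i 1 + Finsupp.indicator N fun _ _ => 1 := by
  set n : ι →₀ ℕ := Finsupp.indicator N fun _ _ => 1 with hn
  have h1 : ((∑ i, X i) * ∏ i ∈ N, X i : MvPolynomial ι κ) =
      ∑ i, monomial (Finsupp.single i 1 + n) 1 := by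
    rw [prod_X_eq_monomial, Finset.sum_mul]
    refine Finset.sum_congr rfl fun i _ => ?_
    rw [X, monomial_mul, one_mul]
  rw [h1, mem_support_iff, coeff_sum]
  simp only [coeff_monomial]
  constructor
  · intro h
    obtain ⟨i, -, hi⟩ := Finset.exists_ne_zero_of_sum_ne_zero h
    exact ⟨i, by by_contra hne; exact hi (if_neg (Ne.symm hne))⟩
  · rintro ⟨i, rfl⟩
    simp [Finsupp.single_left_inj]

theorem min_attained_twice_or_of_mem_tropProj {N : Finset ι} {w : HomogeneousCoords ι}
    (h : mk w ∈ tropProj (-((∑ i, X i) * ∏ i ∈ N, X i) : MvPolynomial ι κ)) :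
    (∃ i ∈ N, w.1 i = ⊤) ∨ ∃ a b, a ≠ b ∧ w.1 a = w.1 b ∧ ∀ i, w.1 a ≤ w.1 i := by
  classical
  rcases h with h | ⟨i, hi, hw⟩
  · right
    have hsub : torusHypersurface (-((∑ i, X i) * ∏ i ∈ N, X i) : MvPolynomial ι κ) ⊆
        {p | ∃ w, p = mk w ∧ ∃ a b, a ≠ b ∧ w.1 a = w.1 b ∧ ∀ i, w.1 a ≤ w.1 i} := by
      rintro _ ⟨u, hu, hmin, rfl⟩
      refine ⟨_, rfl, ?_⟩
      obtain ⟨i₀, -⟩ := hu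
      rcases hmin with h0 | ⟨α, hα, β, hβ, hne, heq, hmin⟩
      · rw [← support_eq_empty, support_neg] at h0
        have := (support_sum_X_mul_prod_X (κ := κ) N _).mpr ⟨i₀, rfl⟩
        rw [h0] at this
        simp at this
      · rw [support_neg] at hα hβ hmin
        obtain ⟨a, rfl⟩ := (support_sum_X_mul_prod_X N _).mp hα
        obtain ⟨b, rfl⟩ := (support_sum_X_mul_prod_X N _).mp hβ
        refine ⟨a, b, ?_, ?_, fun i => ?_⟩
        · rintro rfl; exact hne rfl
        · rw [weight_add, weight_add, weight_single, weight_single] at heq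
          exact WithTop.coe_inj.mpr (add_right_cancel heq)
        · have := hmin _ ((support_sum_X_mul_prod_X N _).mpr ⟨i, rfl⟩)
          rw [weight_add, weight_add, weight_single, weight_single] at this
          exact WithTop.coe_le_coe.mpr (by linarith)
    obtain ⟨w', hw', a, b, hab, heq, hmin⟩ :=
      closure_minimal hsub isClosed_setOf_min_attained_twice h
    obtain ⟨c, hc⟩ := Quotient.exact hw'.symm
    refine ⟨a, b, hab, by rw [hc, hc, heq], fun i => ?_⟩
    rw [hc, hc]
    gcongr
    exact hmin i
  · left
    rw [dvd_neg, X_dvd_mul_iff] at hi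
    rcases hi with hi | hi
    -- The sum is divisible by `X i` only if `i` is the sole index, but `w` has a finite coordinate
    -- and its `i`-th one is infinite.
    · exfalso
      obtain ⟨j, hj⟩ := w.2
      have := X_dvd_iff_forall_coeff.mp hi (Finsupp.single j 1) (by
        rw [mem_support_iff, coeff_single_sum_X, if_pos (Finset.mem_univ j)]
        exact one_ne_zero)
      have hij : j = i := by
        by_contra hne
        simp [hne] at this
      rw [mk_mem_facet, ← hij] at hw
      exact hj hw
    · exact ⟨i, X_dvd_prod_X hi, mk_mem_facet.mp hw⟩

end Closure

/-! ### The tropical basis -/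

namespace PlaneEmbedding

variable {κ : Type*} [Field κ] {V : Type*} [Finite V] {G : SimpleGraph V} (E : PlaneEmbedding G)

/-- Setting the variables outside `S` to zero turns the linear form of the line into the sum over
`S`. -/
theorem lineIdeal_le_coordIdeal_sup {v : V} {S : Set E.InteriorFace}
    (hS : ∀ F ∈ S, E.Incident F.1 v) [Fintype S] :
    E.lineIdeal κ v ≤ coordIdeal κ S ⊔ Ideal.span {∑ F ∈ S.toFinset, X F} := by
  classical
  rw [lineIdeal, Ideal.span_le]
  have hX : ∀ F ∉ S, (X F : MvPolynomial E.InteriorFace κ) ∈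
      coordIdeal κ S ⊔ Ideal.span {∑ F ∈ S.toFinset, X F} := fun F hF =>
    Ideal.mem_sup_left (X_mem_coordIdeal hF)
  rintro f (⟨F, hF, rfl⟩ | ⟨-, rfl⟩)
  · exact hX F fun h => hF (hS F h)
  · have hsub : S.toFinset ⊆ Finset.univ.filter fun F : E.InteriorFace => E.Incident F.1 v :=
      fun F hF => Finset.mem_filter.mpr ⟨Finset.mem_univ _, hS F (Set.mem_toFinset.mp hF)⟩
    rw [← Finset.sum_sdiff hsub]
    refine add_mem (sum_mem fun F hF => hX F fun h => ?_)
      (Ideal.mem_sup_right (Ideal.subset_span rfl))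
    exact (Finset.mem_sdiff.mp hF).2 (Set.mem_toFinset.mpr h)

theorem lineIdeal_le_coordIdeal {v : V} (hv : E.IsExterior v) {S : Set E.InteriorFace}
    (hS : ∀ F ∈ S, E.Incident F.1 v) : E.lineIdeal κ v ≤ coordIdeal κ S := by
  rw [lineIdeal, Ideal.span_le]
  rintro f (⟨F, hF, rfl⟩ | ⟨h, -⟩)
  · exact X_mem_coordIdeal fun h => hF (hS F h)
  · exact absurd hv h

theorem isTropicalBasis_schoenGenerators (hG : G.Connected) :
    IsTropicalBasis (E.schoenGenerators κ) (E.schoenIdeal κ) := by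
  classical
  have hmem : ∀ f ∈ E.schoenGenerators κ, f ∈ E.schoenIdeal κ ∧ ∃ n, f.IsHomogeneous n :=
    fun f hf => ⟨by rw [← E.span_schoenGenerators hG]; exact Ideal.subset_span hf,
      E.isHomogeneous_of_mem_schoenGenerators hf⟩
  refine ⟨hmem, Set.Subset.antisymm ?_ fun p hp =>
    Set.mem_iInter₂.mpr fun f hf => hp f (hmem f hf).1 (hmem f hf).2⟩
  rintro ⟨w⟩ hp f hf -
  change TropicalProjectiveSpace.mk w ∈ _ at hp
  change TropicalProjectiveSpace.mk w ∈ _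
  have hgen : ∀ N, IsMinimalNonface E.dualComplex N →
      TropicalProjectiveSpace.mk w ∈ tropProj (E.outerSubst κ (∏ F ∈ N, X F)) := fun N hN =>
    Set.mem_iInter₂.mp hp _ ⟨_, ⟨N, hN, rfl⟩, rfl⟩
  set S : Set E.InteriorFace := {F | w.1 F ≠ ⊤} with hS
  set S' : Finset E.Face := S.toFinset.image Subtype.val with hS'
  have hmemS' : ∀ F (hF : F ∈ S'), ∃ h : F ≠ E.outer, w.1 ⟨F, h⟩ ≠ ⊤ := by
    intro F hF
    obtain ⟨F, hFS, rfl⟩ := Finset.mem_image.mp hF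
    exact ⟨F.2, by simpa [hS] using hFS⟩
  -- Otherwise a minimal nonface among the finite coordinates, which avoids the outer face, gives a
  -- monomial generator whose tropicalization misses `w`.
  have hface : S' ∈ E.dualComplex.faces := by
    by_contra hnot
    have hne : S'.Nonempty := by
      obtain ⟨F, hF⟩ := w.2
      exact ⟨F.1, Finset.mem_image_of_mem _ (by simpa [hS] using hF)⟩
    obtain ⟨N, hNS, hN⟩ := exists_isMinimalNonface_subset hne hnot
    have hout : E.outer ∉ N := fun h => (hmemS' _ (hNS h)).1 rfl
    have h1 := hgen N hN
    rw [E.outerSubst_prod_of_notMem hout] at h1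
    obtain ⟨F, hF, hw⟩ := exists_eq_top_of_mem_tropProj_prod_X h1
    exact (hmemS' _ (hNS (Finset.mem_subtype.mp hF))).2 hw
  obtain ⟨-, v, hv⟩ := (E.mem_dualComplex_faces S').mp hface
  have hSv : ∀ F ∈ S, E.Incident F.1 v := fun F hF =>
    hv (Finset.mem_coe.mpr (Finset.mem_image_of_mem _ (Set.mem_toFinset.mpr hF)))
  have hfv : ∀ v, f ∈ E.lineIdeal κ v := fun v => (Submodule.mem_iInf _).mp hf v
  -- If so, the finite coordinates share an exterior vertex, whose line ideal contains no linear
  -- form other than variables among its generators.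
  by_cases hins : insert E.outer S' ∈ E.dualComplex.faces
  · obtain ⟨-, u, hu⟩ := (E.mem_dualComplex_faces _).mp hins
    refine mk_mem_tropProj_of_mem_coordIdeal
      (E.lineIdeal_le_coordIdeal (hu (Finset.mem_insert_self _ _)) (fun F hF => ?_) (hfv u))
    exact hu (Finset.mem_insert_of_mem
      (Finset.mem_image_of_mem _ (Set.mem_toFinset.mpr hF)))
  · obtain ⟨N, hNS, hN⟩ := exists_isMinimalNonface_subset (Finset.insert_nonempty _ _) hins
    -- Without the outer face, `N` would be a subset of the simplex `S'`.
    have hout : E.outer ∈ N := by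
      by_contra h
      exact hN.2.1 ((E.mem_dualComplex_faces N).mpr ⟨hN.1, v,
        (Finset.coe_subset.mpr ((Finset.subset_insert_iff_of_notMem h).mp hNS)).trans hv⟩)
    have h1 := hgen N hN
    rw [E.outerSubst_prod_of_mem hout] at h1
    rcases min_attained_twice_or_of_mem_tropProj h1 with ⟨F, hF, hw⟩ | ⟨a, b, hab, heq, hmin⟩
    · have := (Finset.mem_insert.mp (hNS (Finset.mem_subtype.mp hF))).resolve_left F.2
      exact absurd hw (hmemS' _ this).2
    · have ha : w.1 a ≠ ⊤ := by
        obtain ⟨F, hF⟩ := w.2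
        exact ne_top_of_le_ne_top hF (hmin F)
      exact mk_mem_tropProj_of_mem_sup (T := S.toFinset) (by simp [hS])
        (Set.mem_toFinset.mpr ha) (Set.mem_toFinset.mpr (show w.1 b ≠ ⊤ from heq ▸ ha)) hab heq
        (fun i _ => hmin i) (E.lineIdeal_le_coordIdeal_sup hSv (hfv v))

end PlaneEmbedding

end Schoen

end

theorem theorem3p4 {κ : Type*} [Field κ] [IsAlgClosed κ]
    {V : Type*} [Fintype V] [DecidableEq V] (G : SimpleGraph V) [DecidableRel G.Adj]
    (hreg : G.IsRegularOfDegree 3) (hconn : Schoen.IsThreeConnected G)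
    (E : Schoen.PlaneEmbedding G) :
    Schoen.IsMinimalGeneratingSet (E.schoenGenerators κ) (E.schoenIdeal κ) ∧
      Schoen.IsTropicalBasis (E.schoenGenerators κ) (E.schoenIdeal κ) := by
  have hdeg : ∀ v, ∃ w, G.Adj v w := fun v =>
    (G.degree_pos_iff_exists_adj v).mp (by rw [hreg v]; norm_num)
  exact ⟨E.isMinimalGeneratingSet_schoenGenerators hconn.connected hdeg,
    E.isTropicalBasis_schoenGenerators hconn.connected⟩
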